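/- Let $E$ be a non-compact Polish space with a fixed compatible metric and Borel $\sigma$-algebra $\mathscr{E}$; bounded sets are understood with respect to this metric, and a function is called locally bounded if it is bounded on every bounded set. Let $(X_t)_{t\ge 0}$ be a non-explosive (that is, $E$-valued for all $t\in[0,\infty)$), time-homogeneous, right-continuous Markov process on $E$ with respect to a filtration $(\mathscr{F}_t)_{t\ge0}$ (for instance its natural filtration), with laws $(\mathbb{P}_x)_{x\in E}$, $\mathbb{P}_x(X_0=x)=1$, and transition function $P_t(x,\cdot)$, $P_t(x,E)=1$. Assume that the process is ergodic: there is a unique invariant probability measure $\pi$ (a probability measure with $\pi(A)=\int_E P_t(x,A)\,\pi(dx)$ for all $t>0$, $A\in\mathscr{E}$), and $\lim_{t\to\infty}\|P_t(x,\cdot)-\pi\|_{\mathrm{Var}}=0$ for every $x\in E$, where $\|\cdot\|_{\mathrm{Var}}$ is the total variation norm. A pair of measurable functions $f, Lf:E\to\mathbb{R}$ is in the extended generator, written $f\in D_w(L)$, if, under every $\mathbb{P}_x$, $\int_0^t|Lf(X_s)|\,ds<\infty$ for all $t$ almost surely and $f(X_t)-f(X_0)-\int_0^t Lf(X_s)\,ds$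 is a local martingale (with almost surely right-continuous paths). A measurable function $f:E\to[0,\infty)$ is norm-like if $\{x: f(x)\le r\}$ is relatively compact for every $r>0$. Let $(E_n)_{n\ge1}$ be an increasing sequence of bounded open sets with $\bigcup_n E_n=E$, and let $H\subset E_1$ be a closed set with $\pi(H)>0$. Suppose that there are norm-like functions $u,v\in D_w(L)$ such that (a) $Lu(x)\ge -1$ for all $x\notin H$, and $u$ is locally bounded; (b) there is a constant $d>0$ with $Lv(x)\le d\,\mathbf{1}_H(x)$ for all $x\in E$; (c) $\lim_{n\to\infty}\sup_{x\notin E_n}u(x)/v(x)=0$. Then the process is not strongly ergodic: there do not exist $\varepsilon>0$, $C>0$ and an invariant probability measure $\pi'$ such that $\sup_{x\in E}\|P_t(x,\cdot)-\pi'\|_{\mathrm{Var}}\le C e^{-\varepsilon t}$ for all $t\ge0$. -/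

import Mathlib

open MeasureTheory ProbabilityTheory Filter Topology
open scoped NNReal ENNReal

noncomputable section

/-- Total variation norm `‖μ - ν‖_Var` of the difference of two finite measures. -/
def tvNorm {E : Type*} [MeasurableSpace E] (μ ν : Measure E) [IsFiniteMeasure μ]
    [IsFiniteMeasure ν] : ℝ≥0∞ :=
  (μ.toSignedMeasure - ν.toSignedMeasure).totalVariation Set.univ

/-- `X` is a time-homogeneous right-continuous Markov process with state space `E`, transition
function `P_t(x, ·) = κ t x` and laws `P x` (`x` is the starting point), with respect to the
filtration `𝓕` (the natural filtration of `X` is a special case).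
The process lives in `E` at all times `t ∈ [0, ∞)`, so its lifetime is infinite. -/
structure IsRightContinuousMarkovProcess {E Ω : Type*} [TopologicalSpace E] [MeasurableSpace E]
    {mΩ : MeasurableSpace Ω} (κ : ℝ≥0 → Kernel E E) (𝓕 : Filtration ℝ≥0 mΩ)
    (X : ℝ≥0 → Ω → E) (P : E → Measure Ω) : Prop where
  isProbabilityMeasure : ∀ x, IsProbabilityMeasure (P x)
  adapted : ∀ t, Measurable[𝓕 t] (X t)
  rightContinuous : ∀ ω t, ContinuousWithinAt (fun s => X s ω) (Set.Ici t) t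
  initial : ∀ x, ∀ᵐ ω ∂(P x), X 0 ω = x
  markov : ∀ (x : E) (s t : ℝ≥0) (A : Set E), MeasurableSet A →
    (P x)[(X (s + t) ⁻¹' A).indicator (fun _ => (1 : ℝ)) | 𝓕 s]
      =ᵐ[P x] fun ω => (κ t (X s ω)).real A

/-- `π` is an invariant measure for the transition function `κ`:
`π(A) = ∫ P_t(x, A) π(dx)` for all `t > 0` and measurable `A`. -/
def IsInvariantMeasure {E : Type*} [MeasurableSpace E] (κ : ℝ≥0 → Kernel E E)
    (π : Measure E) : Prop :=
  ∀ t : ℝ≥0, 0 < t → Kernel.Invariant (κ t) π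

/-- The transition function `κ` is ergodic and `π` is its unique invariant probability measure:
`‖P_t(x, ·) - π‖_Var → 0` as `t → ∞` for every `x`. -/
structure IsErgodicWith {E : Type*} [MeasurableSpace E] (κ : ℝ≥0 → Kernel E E)
    [∀ t, IsMarkovKernel (κ t)] (π : Measure E) [IsProbabilityMeasure π] : Prop where
  invariant : IsInvariantMeasure κ π
  unique : ∀ π' : Measure E, IsProbabilityMeasure π' → IsInvariantMeasure κ π' → π' = π
  tendsto : ∀ x, Tendsto (fun t => tvNorm (κ t x) π) atTop (𝓝 0)

/-- Strong (uniform) ergodicity: for some `ε > 0`, `C > 0` and invariant probability measure `π`,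
`sup_x ‖P_t(x, ·) - π‖_Var ≤ C e^{-ε t}` for all `t ≥ 0`. -/
def IsStronglyErgodic {E : Type*} [MeasurableSpace E] (κ : ℝ≥0 → Kernel E E)
    [∀ t, IsMarkovKernel (κ t)] : Prop :=
  ∃ ε > (0 : ℝ), ∃ C > (0 : ℝ), ∃ (π : Measure E) (_ : IsProbabilityMeasure π),
    IsInvariantMeasure κ π ∧
      ∀ t : ℝ≥0, ⨆ x, tvNorm (κ t x) π ≤ ENNReal.ofReal (C * Real.exp (-ε * t))

/-- Local martingales in continuous time, with the usual convention that (almost all) paths are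
right-continuous: there are stopping times increasing to infinity such that each stopped process
is a martingale. -/
structure IsLocalMartingale {Ω : Type*} {mΩ : MeasurableSpace Ω} (M : ℝ≥0 → Ω → ℝ)
    (𝓕 : Filtration ℝ≥0 mΩ) (μ : Measure Ω) : Prop where
  rightContinuous : ∀ᵐ ω ∂μ, ∀ t, ContinuousWithinAt (fun s => M s ω) (Set.Ici t) t
  locally_martingale : Locally (fun Y => Martingale Y 𝓕 μ) 𝓕 M μ

/-- `f` belongs to the domain `D_w(L)` of the extended generator and `g` is a version of `L f`:
`f` and `g` are measurable, `s ↦ g(X_s)` is almost surely integrable over bounded time intervals,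
and `f(X_t) - f(X_0) - ∫_0^t g(X_s) ds` is a local martingale under every `P x`. -/
structure IsExtendedGenerator {E Ω : Type*} [MeasurableSpace E] {mΩ : MeasurableSpace Ω}
    (𝓕 : Filtration ℝ≥0 mΩ) (X : ℝ≥0 → Ω → E) (P : E → Measure Ω) (f g : E → ℝ) : Prop where
  measurable_fun : Measurable f
  measurable_gen : Measurable g
  integrable : ∀ x, ∀ᵐ ω ∂(P x), ∀ t : ℝ≥0,
    IntervalIntegrable (fun s : ℝ => g (X s.toNNReal ω)) volume 0 t
  localMartingale : ∀ x, IsLocalMartingale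
    (fun t ω => f (X t ω) - f (X 0 ω) - ∫ s in (0 : ℝ)..t, g (X s.toNNReal ω)) 𝓕 (P x)

/-- Norm-like (compact) functions: measurable, non-negative, with precompact level sets
`{f ≤ r}`. -/
structure IsNormLike {E : Type*} [TopologicalSpace E] [MeasurableSpace E] (f : E → ℝ) :
    Prop where
  measurable : Measurable f
  nonneg : ∀ x, 0 ≤ f x
  precompact : ∀ r > (0 : ℝ), IsCompact (closure {x | f x ≤ r})

end

/-! Strong ergodicity makes the mean time to reach `En 1` bounded uniformly in the starting point,
whereas the drift of `u` forces that time to grow with `u`. So `u` would be bounded, and a bounded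
norm-like function makes `E` compact.

In detail, let G be `En 1`, O the complement of the closure of `En n`, and T the first visit to G ∪
O. `IsStronglyErgodic.exists_measureReal_compl_le` gives t₀ and q < 1 such that G is missed at time
t₀ with probability at most q from anywhere. By the Markov property G is missed k times with
probability at most q ^ k, hence E T ≤ t₀ / (1 - q). Dynkin's formula for `u` gives u(x) ≤ E u(X_T)
+ E T. At T either u ≤ C₁ (closure of G) or u ≤ ε v (closure of O), and E v(X_T) ≤ v(x) because `v`
does not increase off G. Thus u(x) ≤ C₁ + ε v(x) + t₀ / (1 - q), where only n depends on ε.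
`le_of_drift_of_skeletonAvoids` carries this out with localization and a finite horizon. -/

/-! ### Optional sampling and localization. -/

/-- Optional sampling for right-continuous martingales at bounded optional times: only
`{T < s} ∈ 𝓕 s` is required of `T`. -/
theorem Martingale.integral_optionalTime {Ω : Type*} {mΩ : MeasurableSpace Ω}
    {𝓕 : Filtration ℝ≥0 mΩ} {μ : Measure Ω} [IsFiniteMeasure μ] {Y : ℝ≥0 → Ω → ℝ}
    (hY : Martingale Y 𝓕 μ)
    (hrc : ∀ᵐ ω ∂μ, ∀ t, ContinuousWithinAt (fun s => Y s ω) (Set.Ici t) t)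
    {T : Ω → ℝ≥0} {t : ℝ≥0} (hT : ∀ s, MeasurableSet[𝓕 s] {ω | T ω < s}) (hTt : ∀ ω, T ω ≤ t) :
    Integrable (fun ω => Y (T ω) ω) μ ∧ ∫ ω, Y (T ω) ω ∂μ = ∫ ω, Y 0 ω ∂μ := by
  -- Round T up to the next point of the grid of mesh 1 / (m + 1). The `+ 1` makes the rounding
  -- strict, so `{D m ≤ i}` is an event `{T < r}` with r ≤ i: this turns an optional time into a
  -- stopping time.
  set D : ℕ → Ω → ℝ≥0 := fun m ω => min t ((⌊((m : ℝ≥0) + 1) * T ω⌋₊ + 1) / ((m : ℝ≥0) + 1))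
    with hD
  have hpos : ∀ m : ℕ, 0 < (m : ℝ≥0) + 1 := fun m => by positivity
  have hDt : ∀ m ω, ((D m ω : ℝ≥0) : WithTop ℝ≥0) ≤ t := fun m ω => by
    exact_mod_cast min_le_left _ _
  have hDge : ∀ m ω, T ω ≤ D m ω := fun m ω => by
    refine le_min (hTt ω) ?_
    rw [le_div_iff₀ (hpos m), mul_comm]
    exact (Nat.lt_floor_add_one _).le
  have hDle : ∀ m ω, D m ω ≤ T ω + 1 / ((m : ℝ≥0) + 1) := fun m ω => by
    refine (min_le_right _ _).trans ?_
    rw [add_div]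
    gcongr
    rw [div_le_iff₀ (hpos m), mul_comm]
    exact Nat.floor_le (zero_le)
  have hDtend : ∀ ω, Tendsto (fun m => D m ω) atTop (𝓝[Set.Ici (T ω)] (T ω)) := fun ω => by
    refine tendsto_nhdsWithin_iff.2 ⟨?_, Eventually.of_forall fun m => hDge m ω⟩
    refine tendsto_of_tendsto_of_tendsto_of_le_of_le tendsto_const_nhds ?_
      (fun m => hDge m ω) (fun m => hDle m ω)
    have := (tendsto_one_div_add_atTop_nhds_zero_nat (𝕜 := ℝ≥0)).const_add (T ω)
    simpa using this
  have hDstop : ∀ m, IsStoppingTime 𝓕 (fun ω => (D m ω : WithTop ℝ≥0)) := fun m i => by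
    by_cases hti : t ≤ i
    · have : {ω | (D m ω : WithTop ℝ≥0) ≤ i} = Set.univ := by
        ext ω
        simpa only [Set.mem_ofPred_eq, Set.mem_univ, iff_true] using
          WithTop.coe_le_coe.2 ((WithTop.coe_le_coe.1 (hDt m ω)).trans hti)
      rw [this]
      exact MeasurableSet.univ
    · have : {ω | (D m ω : WithTop ℝ≥0) ≤ i}
          = {ω | T ω < (⌊((m : ℝ≥0) + 1) * i⌋₊ : ℝ≥0) / ((m : ℝ≥0) + 1)} := by
        ext ω
        simp only [Set.mem_ofPred_eq, WithTop.coe_le_coe, hD, min_le_iff, hti, false_or]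
        rw [div_le_iff₀ (hpos m), lt_div_iff₀ (hpos m), mul_comm i, mul_comm (T ω),
          ← Nat.floor_lt zero_le, ← Nat.add_one_le_iff, Nat.le_floor_iff zero_le]
        push_cast
        rfl
      rw [this]
      refine 𝓕.mono ?_ _ (hT _)
      rw [div_le_iff₀ (hpos m), mul_comm i]
      exact Nat.floor_le zero_le
  have hDcount : ∀ m, (Set.range fun ω => (D m ω : WithTop ℝ≥0)).Countable := fun m => by
    refine (Set.countable_range fun k : ℕ =>
      ((min t (((k : ℝ≥0) + 1) / ((m : ℝ≥0) + 1)) : ℝ≥0) : WithTop ℝ≥0)).mono ?_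
    rintro _ ⟨ω, rfl⟩
    exact ⟨_, rfl⟩
  have hsv : ∀ m, (fun ω => Y (D m ω) ω) =ᵐ[μ] μ[Y t | (hDstop m).measurableSpace] := fun m =>
    hY.stoppedValue_ae_eq_condExp_of_le_const_of_countable_range (hDstop m) (hDt m) (hDcount m)
  have hlim : ∀ᵐ ω ∂μ, Tendsto (fun m => Y (D m ω) ω) atTop (𝓝 (Y (T ω) ω)) := by
    filter_upwards [hrc] with ω hω
    exact (hω (T ω)).tendsto.comp (hDtend ω)
  have hle : ∀ m, (hDstop m).measurableSpace ≤ mΩ := fun m =>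
    (hDstop m).measurableSpace_le
  -- Conditional expectations of the single variable `Y t` are uniformly integrable, which upgrades
  -- almost sure convergence to convergence in L¹.
  have hUI : UniformIntegrable (fun m ω => Y (D m ω) ω) 1 μ :=
    ((hY.integrable t).uniformIntegrable_condExp hle).ae_eq fun m => (hsv m).symm
  have hmem : MemLp (fun ω => Y (T ω) ω) 1 μ := hUI.memLp_of_ae_tendsto hlim
  refine ⟨memLp_one_iff_integrable.1 hmem, ?_⟩
  have hL1 := tendsto_Lp_finite_of_tendsto_ae le_rfl (by simp) hUI.1 hmem hUI.2.1 hlim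
  have h1 := tendsto_integral_of_L1' _ hmem.1
    (Eventually.of_forall fun m => memLp_one_iff_integrable.1 (hUI.memLp m)) hL1
  have h2 : ∀ m, ∫ ω, Y (D m ω) ω ∂μ = ∫ ω, Y 0 ω ∂μ := fun m => by
    rw [integral_congr_ae (hsv m), integral_condExp (hle m)]
    have := hY.setIntegral_eq (zero_le (a := t)) MeasurableSet.univ
    simpa using this.symm
  simp only [h2] at h1
  exact tendsto_nhds_unique h1 tendsto_const_nhds |>.symm ▸ rfl

theorem untopA_coe_min_coe (s r : ℝ≥0) :
    (min (s : WithTop ℝ≥0) (r : WithTop ℝ≥0)).untopA = min s r := by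
  rw [← WithTop.coe_min]
  exact WithTop.untopD_coe _ _

theorem untopA_coe_min_top (s : ℝ≥0) : (min (s : WithTop ℝ≥0) ⊤).untopA = s := by
  rw [min_eq_left le_top]
  exact WithTop.untopD_coe _ _

theorem coe_untopA_min (s : ℝ≥0) (r : WithTop ℝ≥0) :
    (((min (s : WithTop ℝ≥0) r).untopA : ℝ≥0) : WithTop ℝ≥0) = min (s : WithTop ℝ≥0) r := by
  induction r using WithTop.recTopCoe with
  | top => rw [untopA_coe_min_top, min_eq_left le_top]
  | coe r => rw [untopA_coe_min_coe, WithTop.coe_min]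

theorem untopA_min_le (s : ℝ≥0) (r : WithTop ℝ≥0) : (min (s : WithTop ℝ≥0) r).untopA ≤ s := by
  rw [← WithTop.coe_le_coe, coe_untopA_min]
  exact min_le_left _ _

/-- Stopping a right-continuous process preserves right-continuity. -/
theorem continuousWithinAt_comp_untopA_min {F : Type*} [TopologicalSpace F] {g : ℝ≥0 → F}
    (hg : ∀ t, ContinuousWithinAt g (Set.Ici t) t) (r : WithTop ℝ≥0) (t : ℝ≥0) :
    ContinuousWithinAt (fun s : ℝ≥0 => g (min (s : WithTop ℝ≥0) r).untopA) (Set.Ici t) t := by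
  induction r using WithTop.recTopCoe with
  | top => simpa only [untopA_coe_min_top] using hg t
  | coe r =>
    simp only [untopA_coe_min_coe]
    refine ContinuousWithinAt.comp (f := fun s : ℝ≥0 => min s r) (t := Set.Ici (min t r)) (hg _)
      (by fun_prop) ?_
    intro s hs
    exact min_le_min_right r hs

/-- A local martingale null at zero, stopped along its localizing sequence, has mean zero at every
bounded optional time. -/
theorem IsLocalMartingale.exists_localizing_integral_eq_zero {Ω : Type*} {mΩ : MeasurableSpace Ω}
    {𝓕 : Filtration ℝ≥0 mΩ} {μ : Measure Ω} [IsFiniteMeasure μ] {M : ℝ≥0 → Ω → ℝ}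
    (hM : IsLocalMartingale M 𝓕 μ) (hM0 : ∀ ω, M 0 ω = 0) :
    ∃ R : ℕ → Ω → WithTop ℝ≥0, IsLocalizingSequence 𝓕 R μ ∧
      ∀ n (T : Ω → ℝ≥0) (t : ℝ≥0), (∀ s, MeasurableSet[𝓕 s] {ω | T ω < s}) → (∀ ω, T ω ≤ t) →
        Integrable (fun ω => M (min (T ω : WithTop ℝ≥0) (R n ω)).untopA ω) μ ∧
          ∫ ω, M (min (T ω : WithTop ℝ≥0) (R n ω)).untopA ω ∂μ = 0 := by
  obtain ⟨R, hR, hmart⟩ := hM.locally_martingale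
  refine ⟨R, hR, fun n T t hT hTt => ?_⟩
  -- The indicator in the definition of `Locally` is harmless because `M` vanishes at time 0.
  have hY : stoppedProcess (fun i ↦ {ω | ⊥ < R n ω}.indicator (M i)) (R n)
      = fun (s : ℝ≥0) ω => M (min (s : WithTop ℝ≥0) (R n ω)).untopA ω := by
    ext s ω
    simp only [stoppedProcess, Set.indicator_apply, Set.mem_ofPred_eq]
    split_ifs with h
    · rfl
    · have h0 : R n ω = ((0 : ℝ≥0) : WithTop ℝ≥0) := by
        simpa using h
      rw [h0, untopA_coe_min_coe, min_eq_right zero_le, hM0]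
  have hmn := hmart n
  rw [hY] at hmn
  have hrc : ∀ᵐ ω ∂μ, ∀ t, ContinuousWithinAt
      (fun s : ℝ≥0 => M (min (s : WithTop ℝ≥0) (R n ω)).untopA ω) (Set.Ici t) t := by
    filter_upwards [hM.rightContinuous] with ω hω t
    exact continuousWithinAt_comp_untopA_min hω (R n ω) t
  obtain ⟨h1, h2⟩ := Martingale.integral_optionalTime hmn hrc hT hTt
  refine ⟨h1, h2.trans ?_⟩
  have h0 : ∀ ω, (min ((0 : ℝ≥0) : WithTop ℝ≥0) (R n ω)).untopA = 0 := fun ω =>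
    le_antisymm (untopA_min_le 0 _) zero_le
  simp only [h0, hM0, integral_zero]

theorem IsStoppingTime.measurableSet_untopA_min_lt {Ω : Type*} {mΩ : MeasurableSpace Ω}
    {𝓕 : Filtration ℝ≥0 mΩ} {T : Ω → ℝ≥0} (hT : ∀ s, MeasurableSet[𝓕 s] {ω | T ω < s})
    {R : Ω → WithTop ℝ≥0} (hR : IsStoppingTime 𝓕 R) (s : ℝ≥0) :
    MeasurableSet[𝓕 s] {ω | (min (T ω : WithTop ℝ≥0) (R ω)).untopA < s} := by
  have : {ω | (min (T ω : WithTop ℝ≥0) (R ω)).untopA < s} = {ω | T ω < s} ∪ {ω | R ω < s} := by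
    ext ω
    simp only [Set.mem_ofPred_eq, Set.mem_union]
    rw [← WithTop.coe_lt_coe, coe_untopA_min, min_lt_iff, WithTop.coe_lt_coe]
  rw [this]
  exact (hT s).union (hR.measurableSet_lt s)

theorem tendsto_measureReal_localizing_lt {Ω : Type*} {mΩ : MeasurableSpace Ω}
    {𝓕 : Filtration ℝ≥0 mΩ} {μ : Measure Ω} [IsFiniteMeasure μ] {R : ℕ → Ω → WithTop ℝ≥0}
    (hR : IsLocalizingSequence 𝓕 R μ) (t : ℝ≥0) :
    Tendsto (fun n => μ.real {ω | R n ω < t}) atTop (𝓝 0) := by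
  have hm : ∀ n, MeasurableSet {ω | R n ω < t} := fun n =>
    𝓕.le t _ ((hR.isStoppingTime n).measurableSet_lt t)
  have := tendsto_measure_of_ae_tendsto_indicator_of_isFiniteMeasure (μ := μ) atTop
    MeasurableSet.empty hm (by
      filter_upwards [hR.tendsto_top] with ω hω
      filter_upwards [hω.eventually (lt_mem_nhds (WithTop.coe_lt_top t))] with n hn
      simpa using not_lt.2 hn.le)
  have h2 := (ENNReal.tendsto_toReal (by simp)).comp this
  simpa [Measure.real, Function.comp_def] using h2

/-! ### Hitting times of open sets. -/

section HittingTime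

variable {E Ω : Type*} {X : ℝ≥0 → Ω → E} {G : Set E}

/-- The first hitting time of `G` by `X`, truncated at `t`. -/
noncomputable def truncatedHittingTime (X : ℝ≥0 → Ω → E) (G : Set E) (t : ℝ≥0) (ω : Ω) : ℝ≥0 :=
  sInf ({s | X s ω ∈ G} ∪ {t})

theorem truncatedHittingTime_le_of_mem {t s : ℝ≥0} {ω : Ω} (h : X s ω ∈ G) :
    truncatedHittingTime X G t ω ≤ s :=
  csInf_le (OrderBot.bddBelow _) (Set.mem_union_left _ h)

theorem truncatedHittingTime_le (t : ℝ≥0) (ω : Ω) : truncatedHittingTime X G t ω ≤ t :=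
  csInf_le (OrderBot.bddBelow _) (Or.inr rfl)

theorem notMem_of_lt_truncatedHittingTime {t s : ℝ≥0} {ω : Ω}
    (h : s < truncatedHittingTime X G t ω) : X s ω ∉ G := fun hs =>
  (truncatedHittingTime_le_of_mem hs).not_gt h

/-- If X at the hitting time lies off the closure of G, right-continuity keeps the path off G for a
while longer. An infimum below `t` would then be too small, so it must equal `t`. -/
theorem mem_closure_or_of_truncatedHittingTime [TopologicalSpace E] {ω : Ω}
    (hX : ∀ t, ContinuousWithinAt (fun s => X s ω) (Set.Ici t) t) (t : ℝ≥0) :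
    X (truncatedHittingTime X G t ω) ω ∈ closure G ∨ ∀ s ≤ t, X s ω ∉ G := by
  set T := truncatedHittingTime X G t ω with hT
  refine or_iff_not_imp_left.2 fun hcl => ?_
  have hTt : T = t := by
    refine le_antisymm (truncatedHittingTime_le t ω) (not_lt.1 fun hlt => ?_)
    have hev : ∀ᶠ s in 𝓝[≥] T, X s ω ∈ (closure G)ᶜ :=
      hX T (isClosed_closure.isOpen_compl.mem_nhds hcl)
    obtain ⟨b, hb, hbs⟩ := (mem_nhdsGE_iff_exists_Ico_subset' hlt).1 hev
    have : min b t ≤ T := by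
      refine le_csInf ⟨t, Or.inr rfl⟩ ?_
      rintro s (hs | rfl)
      · by_contra! hsb
        refine hbs ⟨?_, hsb.trans_le (min_le_left _ _)⟩ (subset_closure hs)
        exact truncatedHittingTime_le_of_mem hs
      · exact min_le_right _ _
    exact this.not_gt (lt_min hb hlt)
  intro s hs
  rcases hs.lt_or_eq with h | rfl
  · exact notMem_of_lt_truncatedHittingTime (hTt ▸ h)
  · exact fun hmem => hcl (hTt ▸ subset_closure hmem)

/-- The truncated hitting time of an open set by a right-continuous adapted process is an optional
time. -/
theorem measurableSet_truncatedHittingTime_lt [TopologicalSpace E] [MeasurableSpace E]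
    [OpensMeasurableSpace E] {mΩ : MeasurableSpace Ω} {𝓕 : Filtration ℝ≥0 mΩ}
    (hadapted : ∀ t, Measurable[𝓕 t] (X t))
    (hX : ∀ ω t, ContinuousWithinAt (fun s => X s ω) (Set.Ici t) t) (hG : IsOpen G)
    (t s : ℝ≥0) : MeasurableSet[𝓕 s] {ω | truncatedHittingTime X G t ω < s} := by
  by_cases hts : t < s
  · have : {ω | truncatedHittingTime X G t ω < s} = Set.univ :=
      Set.eq_univ_of_forall fun ω => (truncatedHittingTime_le t ω).trans_lt hts
    rw [this]
    exact MeasurableSet.univ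
  obtain ⟨D, hDc, hDd⟩ := TopologicalSpace.exists_countable_dense ℝ≥0
  have : {ω | truncatedHittingTime X G t ω < s} = ⋃ r ∈ D ∩ Set.Iio s, X r ⁻¹' G := by
    ext ω
    simp only [Set.mem_ofPred_eq, Set.mem_iUnion, Set.mem_preimage, exists_prop]
    constructor
    · intro h
      obtain ⟨r, hr | rfl, hrs⟩ := exists_lt_of_csInf_lt ⟨t, Or.inr rfl⟩ h
      -- A visit to an open set persists on some `[r, b)`, which contains a point of the countable
      -- dense set.
      · have hev : ∀ᶠ a in 𝓝[≥] r, X a ω ∈ G := hX ω r (hG.mem_nhds hr)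
        obtain ⟨b, hb, hbs⟩ := (mem_nhdsGE_iff_exists_Ico_subset' hrs).1 hev
        obtain ⟨d, hdD, hd⟩ := hDd.exists_mem_open isOpen_Ioo
          (Set.nonempty_Ioo.2 (lt_min hb hrs))
        exact ⟨d, ⟨hdD, hd.2.trans_le (min_le_right _ _)⟩,
          hbs ⟨hd.1.le, hd.2.trans_le (min_le_left _ _)⟩⟩
      · exact absurd hrs hts
    · rintro ⟨r, ⟨-, hr⟩, hrG⟩
      exact (truncatedHittingTime_le_of_mem hrG).trans_lt hr
  rw [this]
  refine MeasurableSet.biUnion (hDc.mono Set.inter_subset_left) fun r hr => ?_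
  exact 𝓕.mono (le_of_lt hr.2) _ (hadapted r hG.measurableSet)

end HittingTime

/-! ### Geometric tails for avoidance along a skeleton. -/

/-- The event that the skeleton of step `t₀` avoids `G` at its first `k` positive times. -/
def skeletonAvoids {E Ω : Type*} (X : ℝ≥0 → Ω → E) (G : Set E) (t₀ : ℝ≥0) (k : ℕ) : Set Ω :=
  {ω | ∀ j : ℕ, 1 ≤ j → j ≤ k → X (j * t₀) ω ∉ G}

section Markov

variable {E Ω : Type*} [TopologicalSpace E] [MeasurableSpace E] {mΩ : MeasurableSpace Ω}
  {κ : ℝ≥0 → Kernel E E} {𝓕 : Filtration ℝ≥0 mΩ} {X : ℝ≥0 → Ω → E} {P : E → Measure Ω} {G : Set E}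

theorem IsRightContinuousMarkovProcess.measurableSet_skeletonAvoids
    (hX : IsRightContinuousMarkovProcess κ 𝓕 X P) (hG : MeasurableSet G) (t₀ : ℝ≥0) (k : ℕ) :
    MeasurableSet[𝓕 (k * t₀)] (skeletonAvoids X G t₀ k) := by
  have : skeletonAvoids X G t₀ k = ⋂ j : ℕ, ⋂ (_ : 1 ≤ j), ⋂ (_ : j ≤ k), X (j * t₀) ⁻¹' Gᶜ := by
    ext ω
    simp [skeletonAvoids]
  rw [this]
  refine MeasurableSet.iInter fun j => MeasurableSet.iInter fun _ => MeasurableSet.iInter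
    fun hj => ?_
  refine 𝓕.mono ?_ _ (hX.adapted _ hG.compl)
  gcongr

/-- If `G` is reached in time `t₀` with probability at least `1 - q` from every point, then the
skeleton avoids `G` for `k` steps with probability at most `q ^ k`. -/
theorem IsRightContinuousMarkovProcess.measureReal_skeletonAvoids_le
    (hX : IsRightContinuousMarkovProcess κ 𝓕 X P) (hG : MeasurableSet G) {t₀ : ℝ≥0} {q : ℝ}
    (hq : ∀ y, (κ t₀ y).real Gᶜ ≤ q) (x : E) (k : ℕ) :
    (P x).real (skeletonAvoids X G t₀ k) ≤ q ^ k := by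
  have := hX.isProbabilityMeasure x
  have hq0 : 0 ≤ q := measureReal_nonneg.trans (hq x)
  induction k with
  | zero => simp
  | succ k ih =>
    have hB := hX.measurableSet_skeletonAvoids hG t₀ k
    have hle := 𝓕.le (k * t₀)
    have hpre : MeasurableSet (X (k * t₀ + t₀) ⁻¹' Gᶜ) :=
      𝓕.le _ _ (hX.adapted _ hG.compl)
    have hsub : skeletonAvoids X G t₀ (k + 1)
        ⊆ skeletonAvoids X G t₀ k ∩ X (k * t₀ + t₀) ⁻¹' Gᶜ := by
      intro ω hω
      refine ⟨fun j h1 hj => hω j h1 (by omega), ?_⟩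
      have := hω (k + 1) (by omega) le_rfl
      push_cast at this
      rwa [add_mul, one_mul] at this
    have hint : Integrable ((X (k * t₀ + t₀) ⁻¹' Gᶜ).indicator fun _ => (1 : ℝ)) (P x) :=
      (integrable_const 1).indicator hpre
    calc (P x).real (skeletonAvoids X G t₀ (k + 1))
        ≤ (P x).real (skeletonAvoids X G t₀ k ∩ X (k * t₀ + t₀) ⁻¹' Gᶜ) := measureReal_mono hsub
      _ = ∫ ω in skeletonAvoids X G t₀ k,
            (X (k * t₀ + t₀) ⁻¹' Gᶜ).indicator (fun _ => (1 : ℝ)) ω ∂(P x) := by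
          rw [setIntegral_indicator hpre]
          simp
      _ = ∫ ω in skeletonAvoids X G t₀ k, ((P x)[(X (k * t₀ + t₀) ⁻¹' Gᶜ).indicator
            (fun _ => (1 : ℝ)) | 𝓕 (k * t₀)]) ω ∂(P x) :=
          (setIntegral_condExp hle hint hB).symm
      _ ≤ ∫ ω in skeletonAvoids X G t₀ k, q ∂(P x) := by
          refine integral_mono_ae integrable_condExp.integrableOn (integrable_const _) ?_
          refine ae_restrict_of_ae ?_
          filter_upwards [hX.markov x (k * t₀) t₀ _ hG.compl] with ω hω
          rw [hω]
          exact hq _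
      _ ≤ q ^ (k + 1) := by
          rw [setIntegral_const, smul_eq_mul, pow_succ]
          gcongr

end Markov

/-- A time before which `G` is not visited is bounded by the number of skeleton avoidance events. -/
theorem le_sum_indicator_skeletonAvoids {E Ω : Type*} {X : ℝ≥0 → Ω → E} {G : Set E} {t₀ S : ℝ≥0}
    {ω : Ω} (hS : ∀ s < S, X s ω ∉ G) {N : ℕ} (hSN : S ≤ N * t₀) :
    (S : ℝ) ≤
      t₀ * ∑ k ∈ Finset.range N, (skeletonAvoids X G t₀ k).indicator (fun _ => (1 : ℝ)) ω := by
  induction N with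
  | zero => simp_all
  | succ N ih =>
    by_cases h : S ≤ N * t₀
    · refine (ih h).trans ?_
      rw [Finset.sum_range_succ]
      gcongr
      exact le_add_of_nonneg_right (Set.indicator_nonneg (fun _ _ => zero_le_one) _)
    -- Here every skeleton time up to `N * t₀` precedes `S`, so all `N + 1` indicators equal 1. The
    -- term `k = 0`, whose event is everything, accounts for the first step.
    · have hmem : ∀ k ∈ Finset.range (N + 1),
          (skeletonAvoids X G t₀ k).indicator (fun _ => (1 : ℝ)) ω = 1 := fun k hk => by
        refine Set.indicator_of_mem (show ω ∈ skeletonAvoids X G t₀ k from fun j _ hj =>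
          hS _ (lt_of_le_of_lt ?_ (not_le.1 h))) _
        have : j ≤ N := by
          have := Finset.mem_range.1 hk
          omega
        gcongr
      rw [Finset.sum_congr rfl hmem]
      simp only [Finset.sum_const, Finset.card_range, nsmul_eq_mul, mul_one]
      rw [mul_comm]
      exact_mod_cast hSN

theorem ofReal_sub_le_tvNorm {E : Type*} [MeasurableSpace E] (μ ν : Measure E) [IsFiniteMeasure μ]
    [IsFiniteMeasure ν] {A : Set E} (hA : MeasurableSet A) :
    ENNReal.ofReal (ν.real A - μ.real A) ≤ tvNorm μ ν := by
  set s := μ.toSignedMeasure - ν.toSignedMeasure with hs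
  have h1 : s A = μ.real A - ν.real A := by
    simp [hs, Measure.toSignedMeasure_apply_measurable hA]
  have h2 := s.apply_eq_posPart_real_sub_negPart_real hA
  have h3 : ν.real A - μ.real A ≤ s.toJordanDecomposition.negPart.real A := by
    have : 0 ≤ s.toJordanDecomposition.posPart.real A := measureReal_nonneg
    linarith
  refine (ENNReal.ofReal_le_ofReal h3).trans ?_
  rw [Measure.real, ENNReal.ofReal_toReal (measure_ne_top _ _)]
  calc s.toJordanDecomposition.negPart A ≤ s.toJordanDecomposition.negPart Set.univ :=
        measure_mono (Set.subset_univ _)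
    _ ≤ s.totalVariation Set.univ := by
        rw [SignedMeasure.totalVariation, Measure.add_apply]
        exact le_add_self

/-- The open interval matters: at the stopping time itself X may already be in G, where no drift
bound is available. -/
theorem neg_le_integral_of_neg_one_le {f : ℝ → ℝ} {S : ℝ} (hS : 0 ≤ S)
    (hf : IntervalIntegrable f volume 0 S) (h : ∀ r ∈ Set.Ioo 0 S, -1 ≤ f r) :
    -S ≤ ∫ r in (0 : ℝ)..S, f r := by
  have := intervalIntegral.integral_mono_on_of_le_Ioo hS
    (intervalIntegrable_const (c := (-1 : ℝ))) hf h
  simpa using this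

theorem integral_nonpos_of_nonpos_Ioo {f : ℝ → ℝ} {S : ℝ} (hS : 0 ≤ S)
    (hf : IntervalIntegrable f volume 0 S) (h : ∀ r ∈ Set.Ioo 0 S, f r ≤ 0) :
    ∫ r in (0 : ℝ)..S, f r ≤ 0 := by
  have := intervalIntegral.integral_mono_on_of_le_Ioo hS hf
    (intervalIntegrable_const (c := (0 : ℝ))) h
  simpa using this

/-! ### Dynkin comparison of u and v. -/

section Comparison

variable {E Ω : Type*} [TopologicalSpace E] [MeasurableSpace E] {mΩ : MeasurableSpace Ω}
  {κ : ℝ≥0 → Kernel E E} {𝓕 : Filtration ℝ≥0 mΩ} {X : ℝ≥0 → Ω → E} {P : E → Measure Ω}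

/-- Dynkin's formula for `u` and `v` up to the first visit to `G ∪ O`, when `u` decreases at rate at
most one and `v` does not increase off `G`, and `u ≤ ε v` on the closure of `O`. -/
theorem le_of_drift_of_skeletonAvoids [OpensMeasurableSpace E]
    (hX : IsRightContinuousMarkovProcess κ 𝓕 X P) {u v Lu Lv : E → ℝ}
    (hLu : IsExtendedGenerator 𝓕 X P u Lu) (hLv : IsExtendedGenerator 𝓕 X P v Lv)
    (hv0 : ∀ y, 0 ≤ v y) {G O : Set E} (hG : IsOpen G) (hO : IsOpen O) {C₁ C₂ ε : ℝ}
    (hC₁ : 0 ≤ C₁) (hC₂ : 0 ≤ C₂) (hε : 0 ≤ ε) (huG : ∀ y ∈ closure G, u y ≤ C₁)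
    (huO : ∀ y ∈ closure O, u y ≤ ε * v y) (huC : ∀ y, y ∉ O → u y ≤ C₂)
    (hLuG : ∀ y, y ∉ G → -1 ≤ Lu y) (hLvG : ∀ y, y ∉ G → Lv y ≤ 0) {t₀ : ℝ≥0} {q : ℝ}
    {x : E} (htail : ∀ k, (P x).real (skeletonAvoids X G t₀ k) ≤ q ^ k) (N : ℕ) :
    u x ≤ C₁ + ε * v x + C₂ * q ^ N + t₀ * ∑ k ∈ Finset.range N, q ^ k := by
  have := hX.isProbabilityMeasure x
  obtain ⟨R, hR, hRint⟩ := (hLu.localMartingale x).exists_localizing_integral_eq_zero (by simp)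
  obtain ⟨R', hR', hRint'⟩ := (hLv.localMartingale x).exists_localizing_integral_eq_zero (by simp)
  set t : ℝ≥0 := N * t₀ with ht
  set T : Ω → ℝ≥0 := truncatedHittingTime X (G ∪ O) t with hTdef
  have hT : ∀ s, MeasurableSet[𝓕 s] {ω | T ω < s} :=
    measurableSet_truncatedHittingTime_lt hX.adapted hX.rightContinuous (hG.union hO) t
  have hTt : ∀ ω, T ω ≤ t := truncatedHittingTime_le t
  have hBm : ∀ k, MeasurableSet (skeletonAvoids X G t₀ k) := fun k =>
    𝓕.le _ _ (hX.measurableSet_skeletonAvoids hG.measurableSet t₀ k)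
  have key : ∀ n, u x ≤ C₁ + ε * v x + C₂ * ((P x).real {ω | R n ω < t}
      + (P x).real {ω | R' n ω < t} + q ^ N) + t₀ * ∑ k ∈ Finset.range N, q ^ k := by
    intro n
    have hRm : MeasurableSet {ω | R n ω < t} :=
      𝓕.le t _ ((hR.isStoppingTime n).measurableSet_lt t)
    have hRm' : MeasurableSet {ω | R' n ω < t} :=
      𝓕.le t _ ((hR'.isStoppingTime n).measurableSet_lt t)
    -- Both local martingales are stopped at the common time T ∧ R ∧ R', by applying each one's
    -- localization to T already cut by the other's.
    set S : Ω → ℝ≥0 := fun ω =>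
      (min ((min (T ω : WithTop ℝ≥0) (R' n ω)).untopA : WithTop ℝ≥0) (R n ω)).untopA with hS
    have hScoe : ∀ ω, (S ω : WithTop ℝ≥0) = min (min (T ω : WithTop ℝ≥0) (R' n ω)) (R n ω) :=
      fun ω => by rw [hS, coe_untopA_min, coe_untopA_min]
    have hS' : ∀ ω, (min ((min (T ω : WithTop ℝ≥0) (R n ω)).untopA : WithTop ℝ≥0)
        (R' n ω)).untopA = S ω := fun ω => by
      rw [← WithTop.coe_inj, hScoe, coe_untopA_min, coe_untopA_min, min_right_comm]
    have hST : ∀ ω, S ω ≤ T ω := fun ω => by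
      rw [← WithTop.coe_le_coe, hScoe]
      exact (min_le_left _ _).trans (min_le_left _ _)
    obtain ⟨hMi, hM0⟩ := hRint n (fun ω => (min (T ω : WithTop ℝ≥0) (R' n ω)).untopA) t
      (IsStoppingTime.measurableSet_untopA_min_lt hT (hR'.isStoppingTime n))
      (fun ω => (untopA_min_le _ _).trans (hTt ω))
    obtain ⟨hMi', hM0'⟩ := hRint' n (fun ω => (min (T ω : WithTop ℝ≥0) (R n ω)).untopA) t
      (IsStoppingTime.measurableSet_untopA_min_lt hT (hR.isStoppingTime n))
      (fun ω => (untopA_min_le _ _).trans (hTt ω))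
    simp only [hS'] at hMi' hM0'
    change Integrable (fun ω => u (X (S ω) ω) - u (X 0 ω) -
      ∫ s in (0 : ℝ)..(S ω), Lu (X s.toNNReal ω)) (P x) at hMi
    change ∫ ω, (u (X (S ω) ω) - u (X 0 ω) -
      ∫ s in (0 : ℝ)..(S ω), Lu (X s.toNNReal ω)) ∂(P x) = 0 at hM0
    have hind : ∀ {A : Set Ω}, MeasurableSet A →
        Integrable (A.indicator fun _ => (1 : ℝ)) (P x) := fun hA =>
      (integrable_const 1).indicator hA
    have hpath : ∀ᵐ ω ∂(P x), u (X (S ω) ω) - u (X 0 ω) -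
        ∫ s in (0 : ℝ)..(S ω), Lu (X s.toNNReal ω) ≤
        (C₁ + ε * v x - u x) + ε * (v (X (S ω) ω) - v (X 0 ω) -
          ∫ s in (0 : ℝ)..(S ω), Lv (X s.toNNReal ω))
        + C₂ * ({ω | R n ω < t}.indicator (fun _ => (1 : ℝ)) ω
          + {ω | R' n ω < t}.indicator (fun _ => (1 : ℝ)) ω
          + (skeletonAvoids X G t₀ N).indicator (fun _ => (1 : ℝ)) ω)
        + t₀ * ∑ k ∈ Finset.range N,
          (skeletonAvoids X G t₀ k).indicator (fun _ => (1 : ℝ)) ω := by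
      filter_upwards [hX.initial x, hLu.integrable x, hLv.integrable x] with ω h0 hiu hiv
      have hbefore : ∀ s < S ω, X s ω ∉ G ∪ O := fun s hs =>
        notMem_of_lt_truncatedHittingTime (hs.trans_le (hST ω))
      have hbeforeG : ∀ s < S ω, X s ω ∉ G := fun s hs hsG => hbefore s hs (Or.inl hsG)
      have hIoo : ∀ r ∈ Set.Ioo (0 : ℝ) (S ω), X r.toNNReal ω ∉ G := fun r hr =>
        hbeforeG _ ((Real.toNNReal_lt_iff_lt_coe hr.1.le).2 hr.2)
      have hIu := neg_le_integral_of_neg_one_le (S ω).coe_nonneg (hiu (S ω))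
        (fun r hr => hLuG _ (hIoo r hr))
      have hIv := integral_nonpos_of_nonpos_Ioo (S ω).coe_nonneg (hiv (S ω))
        (fun r hr => hLvG _ (hIoo r hr))
      have hSle := le_sum_indicator_skeletonAvoids hbeforeG ((hST ω).trans (hTt ω))
      have hi0 : ∀ A : Set Ω, 0 ≤ A.indicator (fun _ => (1 : ℝ)) ω := fun A =>
        Set.indicator_nonneg (fun _ _ => zero_le_one) _
      have hR0 := hi0 {ω | R n ω < t}
      have hR0' := hi0 {ω | R' n ω < t}
      have hB0 := hi0 (skeletonAvoids X G t₀ N)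
      have hu : u (X (S ω) ω) ≤ C₁ + ε * v (X (S ω) ω)
          + C₂ * ({ω | R n ω < t}.indicator (fun _ => (1 : ℝ)) ω
          + {ω | R' n ω < t}.indicator (fun _ => (1 : ℝ)) ω
          + (skeletonAvoids X G t₀ N).indicator (fun _ => (1 : ℝ)) ω) := by
        have hεv := mul_nonneg hε (hv0 (X (S ω) ω))
        -- If localization stops the path before T, it is still off O, so u ≤ C₂, and one of the two
        -- localization indicators is 1. Otherwise S = T, and either X is in the closure of G ∪ O or
        -- G was avoided up to the horizon.
        rcases (hST ω).lt_or_eq with hlt | heq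
        · have h1 : u (X (S ω) ω) ≤ C₂ := huC _ fun hmem =>
            notMem_of_lt_truncatedHittingTime hlt (Or.inr hmem)
          have h2 : R n ω < t ∨ R' n ω < t := by
            have := WithTop.coe_lt_coe.2 hlt
            rw [hScoe, min_lt_iff, min_lt_iff] at this
            have hle : (T ω : WithTop ℝ≥0) ≤ t := WithTop.coe_le_coe.2 (hTt ω)
            rcases this with (h | h) | h
            · exact absurd h (lt_irrefl _)
            · exact Or.inr (h.trans_le hle)
            · exact Or.inl (h.trans_le hle)
          have h3 : 1 ≤ {ω | R n ω < t}.indicator (fun _ => (1 : ℝ)) ω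
              + {ω | R' n ω < t}.indicator (fun _ => (1 : ℝ)) ω
              + (skeletonAvoids X G t₀ N).indicator (fun _ => (1 : ℝ)) ω := by
            rcases h2 with h | h
            · rw [Set.indicator_of_mem (show ω ∈ {ω | R n ω < t} from h)]
              linarith
            · rw [Set.indicator_of_mem (show ω ∈ {ω | R' n ω < t} from h)]
              linarith
          nlinarith
        · rw [heq] at hεv ⊢
          rcases mem_closure_or_of_truncatedHittingTime (G := G ∪ O)
            (hX.rightContinuous ω) t with hcl | hno
          · have : 0 ≤ C₂ * ({ω | R n ω < t}.indicator (fun _ => (1 : ℝ)) ω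
                + {ω | R' n ω < t}.indicator (fun _ => (1 : ℝ)) ω
                + (skeletonAvoids X G t₀ N).indicator (fun _ => (1 : ℝ)) ω) := by positivity
            rw [closure_union] at hcl
            rcases hcl with h | h
            · linarith [huG _ h]
            · linarith [huO _ h]
          · have h1 : u (X (T ω) ω) ≤ C₂ := huC _ fun hmem => hno _ (hTt ω) (Or.inr hmem)
            have hmem : ω ∈ skeletonAvoids X G t₀ N := fun j _ hj hjG =>
              hno (j * t₀) (by rw [ht]; gcongr) (Or.inl hjG)
            rw [Set.indicator_of_mem hmem]
            nlinarith
      rw [h0]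
      have h5 : ε * (v (X (S ω) ω) - v x) ≤ ε * (v (X (S ω) ω) - v x -
          ∫ s in (0 : ℝ)..(S ω), Lv (X s.toNNReal ω)) :=
        mul_le_mul_of_nonneg_left (by linarith) hε
      linarith
    have hi1 := (hMi'.const_mul ε)
    have hi2 := (((hind hRm).add (hind hRm')).add (hind (hBm N))).const_mul C₂
    have hi3 := (integrable_finsetSum (Finset.range N) fun k _ => hind (hBm k)).const_mul (t₀ : ℝ)
    have hi0 : Integrable (fun _ : Ω => C₁ + ε * v x - u x) (P x) := integrable_const _
    have hmono := integral_mono_ae hMi (((hi0.add hi1).add hi2).add hi3) hpath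
    rw [hM0, integral_add' ((hi0.add hi1).add hi2) hi3, integral_add' (hi0.add hi1) hi2,
      integral_add' hi0 hi1, integral_const_mul, integral_const_mul, integral_const_mul, hM0',
      integral_add' ((hind hRm).add (hind hRm')) (hind (hBm N)),
      integral_add' (hind hRm) (hind hRm'), integral_finsetSum _ fun k _ => hind (hBm k)] at hmono
    simp only [hRm, hRm', hBm, integral_const, probReal_univ, mul_zero, add_zero,
      integral_indicator_const, smul_eq_mul, mul_one] at hmono
    have h1 : C₂ * (P x).real (skeletonAvoids X G t₀ N) ≤ C₂ * q ^ N := by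
      gcongr
      exact htail N
    have h2 : (t₀ : ℝ) * ∑ k ∈ Finset.range N, (P x).real (skeletonAvoids X G t₀ k)
        ≤ t₀ * ∑ k ∈ Finset.range N, q ^ k := by
      gcongr with k
      exact htail k
    linarith
  -- The horizon `t` is fixed, so the probability of localizing before it vanishes as n grows.
  have hlim : Tendsto (fun n => C₁ + ε * v x + C₂ * ((P x).real {ω | R n ω < t}
      + (P x).real {ω | R' n ω < t} + q ^ N) + t₀ * ∑ k ∈ Finset.range N, q ^ k) atTop
      (𝓝 (C₁ + ε * v x + C₂ * (0 + 0 + q ^ N) + t₀ * ∑ k ∈ Finset.range N, q ^ k)) :=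
    (((((tendsto_measureReal_localizing_lt hR t).add
      (tendsto_measureReal_localizing_lt hR' t)).add_const _).const_mul _).const_add _).add_const _
  have := ge_of_tendsto' hlim key
  simpa using this

end Comparison

/-! ### Uniform hitting and the contradiction. -/

/-- A strongly ergodic transition function reaches a set of positive invariant mass at some time
with probability bounded away from zero, uniformly in the starting point. -/
theorem IsStronglyErgodic.exists_measureReal_compl_le {E : Type*} [MeasurableSpace E]
    {κ : ℝ≥0 → Kernel E E} [∀ t, IsMarkovKernel (κ t)] (h : IsStronglyErgodic κ)
    {π : Measure E} [IsProbabilityMeasure π] (hπ : IsErgodicWith κ π) {G : Set E}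
    (hG : MeasurableSet G) (hG0 : 0 < π G) :
    ∃ (t₀ : ℝ≥0) (q : ℝ), 0 ≤ q ∧ q < 1 ∧ ∀ y, (κ t₀ y).real Gᶜ ≤ q := by
  obtain ⟨ε, hε, C, -, π', hπ'p, hπ'i, hle⟩ := h
  obtain rfl := hπ.unique π' hπ'p hπ'i
  have hp : 0 < π'.real G := ENNReal.toReal_pos hG0.ne' (measure_ne_top _ _)
  have hp1 : π'.real G ≤ 1 := measureReal_le_one
  have hlim : Tendsto (fun n : ℕ => C * Real.exp (-ε * n)) atTop (𝓝 (C * 0)) := by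
    refine (Real.tendsto_exp_atBot.comp ?_).const_mul C
    exact tendsto_natCast_atTop_atTop.const_mul_atTop_of_neg (neg_neg_of_pos hε)
  rw [mul_zero] at hlim
  -- At such a time P_t(y, G) is within π(G) / 2 of π(G) for all y, whence q = 1 - π(G) / 2.
  obtain ⟨n, hn⟩ := (hlim.eventually (gt_mem_nhds (half_pos hp))).exists
  refine ⟨n, 1 - π'.real G / 2, by linarith, by linarith, fun y => ?_⟩
  have h1 : ENNReal.ofReal (π'.real G - (κ n y).real G) ≤ ENNReal.ofReal (π'.real G / 2) :=
    (ofReal_sub_le_tvNorm _ _ hG).trans <| (le_iSup (fun y => tvNorm (κ n y) π') y).trans <|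
      (hle n).trans <| ENNReal.ofReal_le_ofReal (by simpa using hn.le)
  have h2 := (ENNReal.ofReal_le_ofReal_iff (half_pos hp).le).1 h1
  rw [probReal_compl_eq_one_sub hG]
  linarith

theorem theorem1 {E Ω : Type*} [MetricSpace E] [PolishSpace E] [NoncompactSpace E]
    [MeasurableSpace E] [BorelSpace E] {mΩ : MeasurableSpace Ω}
    (κ : ℝ≥0 → Kernel E E) [∀ t, IsMarkovKernel (κ t)]
    (𝓕 : Filtration ℝ≥0 mΩ) (X : ℝ≥0 → Ω → E) (P : E → Measure Ω)
    (hX : IsRightContinuousMarkovProcess κ 𝓕 X P)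
    (π : Measure E) [IsProbabilityMeasure π] (hπ : IsErgodicWith κ π)
    (En : ℕ → Set E) (hEn_open : ∀ n, IsOpen (En n))
    (hEn_bdd : ∀ n, Bornology.IsBounded (En n))
    (hEn_mono : Monotone En) (hEn_union : ⋃ n, En n = Set.univ)
    (H : Set E) (hH_closed : IsClosed H) (hH_sub : H ⊆ En 1) (hH_pos : 0 < π H)
    (u v Lu Lv : E → ℝ) (hu : IsNormLike u) (hv : IsNormLike v)
    (hLu : IsExtendedGenerator 𝓕 X P u Lu) (hLv : IsExtendedGenerator 𝓕 X P v Lv)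
    (ha : ∀ x, x ∉ H → -1 ≤ Lu x)
    (hu_bdd : ∀ B : Set E, Bornology.IsBounded B → BddAbove (u '' B))
    (hb : ∃ d > (0 : ℝ), ∀ x, Lv x ≤ d * H.indicator (fun _ => (1 : ℝ)) x)
    (hc : Tendsto
      (fun n => ⨆ x ∈ (En n)ᶜ, ENNReal.ofReal (u x) / ENNReal.ofReal (v x)) atTop (𝓝 0)) :
    ¬ IsStronglyErgodic κ := by
  intro hse
  -- The open set `En 1` replaces the closed set `H`: its hitting time is an optional time, and `u`
  -- is bounded on its closure.
  obtain ⟨t₀, q, hq0, hq1, hq⟩ := hse.exists_measureReal_compl_le hπ (hEn_open 1).measurableSet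
    (hH_pos.trans_le (measure_mono hH_sub))
  have hbound : ∀ B : Set E, Bornology.IsBounded B → ∃ C, 0 ≤ C ∧ ∀ y ∈ B, u y ≤ C := by
    intro B hB
    obtain ⟨C, hC⟩ := hu_bdd B hB
    exact ⟨max C 0, le_max_right _ _, fun y hy =>
      (hC (Set.mem_image_of_mem u hy)).trans (le_max_left _ _)⟩
  obtain ⟨C₁, hC₁, huC₁⟩ := hbound _ (hEn_bdd 1).closure
  have hLv0 : ∀ y, y ∉ En 1 → Lv y ≤ 0 := by
    obtain ⟨d, -, hd⟩ := hb
    intro y hy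
    simpa [Set.indicator_of_notMem (fun hyH => hy (hH_sub hyH) : y ∉ H)] using hd y
  have hsum : ∀ N, ∑ k ∈ Finset.range N, q ^ k ≤ (1 - q)⁻¹ := fun N => by
    rw [← tsum_geometric_of_lt_one hq0 hq1]
    exact (summable_geometric_of_lt_one hq0 hq1).sum_le_tsum _ fun k _ => pow_nonneg hq0 k
  have hle : ∀ x, ∀ ε > 0, u x ≤ C₁ + t₀ * (1 - q)⁻¹ + ε * v x := by
    intro x ε hε
    obtain ⟨n, hn⟩ :=
      (hc.eventually (gt_mem_nhds (ENNReal.ofReal_pos.2 hε))).exists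
    have huv : ∀ y ∉ En n, u y ≤ ε * v y := by
      intro y hy
      have h1 : ENNReal.ofReal (u y) / ENNReal.ofReal (v y) ≤ ENNReal.ofReal ε :=
        (le_iSup₂ (f := fun x (_ : x ∈ (En n)ᶜ) =>
          ENNReal.ofReal (u x) / ENNReal.ofReal (v x)) y hy).trans hn.le
      have h2 : ENNReal.ofReal (u y) ≤ ENNReal.ofReal ε * ENNReal.ofReal (v y) := by
        -- Where `v y = 0` the quotient is infinite unless `u y = 0`, so no case distinction is
        -- needed.
        refine (ENNReal.div_le_iff_le_mul (Or.inr ENNReal.ofReal_ne_top)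
          (Or.inl ENNReal.ofReal_ne_top)).1 h1
      rw [← ENNReal.ofReal_mul hε.le] at h2
      exact (ENNReal.ofReal_le_ofReal_iff (mul_nonneg hε.le (hv.nonneg y))).1 h2
    obtain ⟨C₂, hC₂, huC₂⟩ := hbound _ (hEn_bdd n).closure
    have hstep : ∀ N : ℕ, u x ≤ C₁ + t₀ * (1 - q)⁻¹ + ε * v x + C₂ * q ^ N := by
      intro N
      -- O is the complement of `closure (En n)`. Its closure stays in the closed set `(En n)ᶜ`,
      -- where u ≤ ε v, and off O the bound C₂ holds. C₂ depends on ε but disappears as N → ∞.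
      have h1 := le_of_drift_of_skeletonAvoids hX hLu hLv hv.nonneg (hEn_open 1)
        (isClosed_closure (s := En n)).isOpen_compl hC₁ hC₂ hε.le huC₁
        (fun y hy => huv y ?_) (fun y hy => huC₂ y (not_not.1 hy))
        (fun y hy => ha y fun hyH => hy (hH_sub hyH)) hLv0
        (hX.measureReal_skeletonAvoids_le (hEn_open 1).measurableSet hq x) N
      · have h2 : (t₀ : ℝ) * ∑ k ∈ Finset.range N, q ^ k ≤ t₀ * (1 - q)⁻¹ := by
          gcongr
          exact hsum N
        linarith
      · exact closure_minimal (Set.compl_subset_compl.2 subset_closure)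
          (hEn_open n).isClosed_compl hy
    have hlim := ((tendsto_pow_atTop_nhds_zero_of_lt_one hq0 hq1).const_mul C₂).const_add
      (C₁ + t₀ * (1 - q)⁻¹ + ε * v x)
    rw [mul_zero, add_zero] at hlim
    exact ge_of_tendsto' hlim hstep
  have hbdd : ∀ x, u x ≤ C₁ + t₀ * (1 - q)⁻¹ + 1 := by
    intro x
    have hv1 : 0 < v x + 1 := by linarith [hv.nonneg x]
    -- This ε may depend on x, since the other constants do not depend on ε; it makes ε v(x) ≤ 1.
    have h1 := hle x (v x + 1)⁻¹ (inv_pos.2 hv1)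
    have h2 : (v x + 1)⁻¹ * v x ≤ 1 := by
      rw [inv_mul_le_iff₀ hv1]
      linarith
    linarith
  have hpos : 0 < C₁ + t₀ * (1 - q)⁻¹ + 1 := by
    have : 0 < 1 - q := by linarith
    positivity
  have hcomp := hu.precompact _ hpos
  rw [Set.eq_univ_of_forall (s := {x | u x ≤ C₁ + t₀ * (1 - q)⁻¹ + 1}) hbdd, closure_univ] at hcomp
  exact noncompact_univ E hcomp
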